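/- Let $\mathbb{D}=\{z\in\mathbb{C}:|z|<1\}$, let $\mathcal{A}$ be the class of analytic functions $f$ on $\mathbb{D}$ with $f(0)=0$, $f'(0)=1$, written $f(z)=z+\sum_{n\ge 2}a_nz^n$ (and $a_1=1$), and let $\sinh^{-1}$ denote the principal branch $\sinh^{-1}z=\log\bigl(z+\sqrt{1+z^2}\bigr)$, which is analytic on $\mathbb{D}$. Let $\mathcal{S}^*_\rho$ be the class of all $f\in\mathcal{A}$ with $f(z)\neq 0$ for $0<|z|<1$ and $$\frac{zf'(z)}{f(z)}\prec 1+\sinh^{-1}z ,$$ that is, there is an analytic $w:\mathbb{D}\to\mathbb{C}$ with $w(0)=0$ and $|w(z)|\le|z|$ on $\mathbb{D}$ such that $zf'(z)/f(z)=1+\sinh^{-1}(w(z))$ on $\mathbb{D}$ (the left side being $1$ at $z=0$). Let $$H_{3,1}(f)=\begin{vmatrix}a_1&a_2&a_3\\a_2&a_3&a_4\\a_3&a_4&a_5\end{vmatrix}.$$ Then for every $f\in\mathcal{S}^*_\rho$, $$H_{3,1}(f)=2a_2a_3a_4-a_3^3-a_4^2-a_2^2a_5+a_3a_5\quad\text{and}\quad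 |H_{3,1}(f)|\le\frac19 .$$ The bound is sharp: the function $f_0(z)=z\exp\left(\int_0^z\frac{\sinh^{-1}(t^3)}{t}\,dt\right)$ belongs to $\mathcal{S}^*_\rho$ and satisfies $|H_{3,1}(f_0)|=\frac19$. -/

import Mathlib

namespace PetalStarlike

noncomputable section

/-- The open unit disc. -/
def unitDisc : Set ℂ := Metric.ball (0 : ℂ) 1

/-- The principal branch of the inverse hyperbolic sine,
`arcsinh z = log (z + (1 + z ^ 2) ^ (1 / 2))` with principal logarithm and principal square root.
Its cuts are the rays `(-i∞, -i)` and `(i, i∞)`; it is analytic on the unit disc. -/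
def arcsinh (z : ℂ) : ℂ := Complex.log (z + (1 + z ^ 2) ^ (1 / 2 : ℂ))

/-- The class `𝒜` of normalized analytic functions `f z = z + a₂ z ^ 2 + ⋯` on the unit disc.
Only the values of `f` on the unit disc matter. -/
def NormalizedAnalytic (f : ℂ → ℂ) : Prop :=
  AnalyticOnNhd ℂ f unitDisc ∧ f 0 = 0 ∧ deriv f 0 = 1

/-- Subordination `g₁ ≺ g₂` on the unit disc: `g₁ = g₂ ∘ w` for some Schwarz function `w`. -/
def Subordinate (g₁ g₂ : ℂ → ℂ) : Prop :=
  ∃ w : ℂ → ℂ, AnalyticOnNhd ℂ w unitDisc ∧ w 0 = 0 ∧ (∀ z ∈ unitDisc, ‖w z‖ ≤ ‖z‖) ∧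
    ∀ z ∈ unitDisc, g₁ z = g₂ (w z)

/-- The function `z f'(z) / f(z)`, with its removable singularity at the origin filled in
by the value `1` (for normalized `f`). -/
def starQuotient (f : ℂ → ℂ) (z : ℂ) : ℂ := if z = 0 then 1 else z * deriv f z / f z

/-- The class `S*_ρ`: normalized analytic `f`, without zeros in the punctured disc (so that
`z f'(z) / f(z)` is a genuine analytic function there), with `z f'/f ≺ 1 + arcsinh z`. -/
def StarlikeRho (f : ℂ → ℂ) : Prop :=
  NormalizedAnalytic f ∧ (∀ z ∈ unitDisc, z ≠ 0 → f z ≠ 0) ∧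
    Subordinate (starQuotient f) (fun z => 1 + arcsinh z)

/-- The `n`-th Taylor coefficient of `f` at the origin. -/
def coeff (f : ℂ → ℂ) (n : ℕ) : ℂ := iteratedDeriv n f 0 / (n.factorial : ℂ)

/-- The Hankel determinant `H_{q,n}(f) = det (a_{n+i+j})_{0 ≤ i, j < q}`. -/
def hankelDet (q n : ℕ) (f : ℂ → ℂ) : ℂ :=
  Matrix.det (Matrix.of fun i j : Fin q => coeff f (n + (i : ℕ) + (j : ℕ)))

/-- The function `z * exp (∫₀ᶻ arcsinh (t ^ 3) / t dt)`, the integral being taken along the segment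
`t = s z`, `0 ≤ s ≤ 1`. -/
def extremal (z : ℂ) : ℂ :=
  z * Complex.exp (∫ s in (0 : ℝ)..1, arcsinh (((s : ℂ) * z) ^ 3) / ((s : ℂ) * z) * z)

end

end PetalStarlike

namespace PetalStarlike

open Metric Set Filter Topology ComplexConjugate

/-! Writing `z f' / f = 1 + arcsinh ∘ w` and comparing coefficients turns `144 * H_{3,1}` into a
polynomial in the first four coefficients of the Schwarz function `w` (`hankelDet_eq_of_schwarz`).
The Schur algorithm expresses these through parameters `c, x, y, ζ` of the closed disc
(`exists_schur_parameters`). The resulting expression is affine in `ζ` and quadratic in `y`, up to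
the factor `1 - |y|²` of `ζ`, so the triangle inequality leaves a real majorant in `|c|, |x|, |y|`,
to be bounded by 16.

Replacing `|y|` by 1 in the linear term makes the majorant a convex combination, with weights `|y|²`
and `1 - |y|²`, of two functions of `|c|, |x|`. Odd powers of `|c|` are removed by AM-GM; what
remains is a binary cubic form in `|c|²` and `1 - |c|²`, handled by `cubic_form_nonneg`. The value
16 occurs at `c = x = 0`, `|y| = 1`, that is for `w = z³`, which gives the extremal function. -/

theorem isOpen_unitDisc : IsOpen unitDisc := isOpen_ball

theorem mem_unitDisc {z : ℂ} : z ∈ unitDisc ↔ ‖z‖ < 1 := by simp [unitDisc]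

theorem zero_mem_unitDisc : (0 : ℂ) ∈ unitDisc := by simp [mem_unitDisc]

theorem unitDisc_mem_nhds_zero : unitDisc ∈ 𝓝 (0 : ℂ) :=
  isOpen_unitDisc.mem_nhds zero_mem_unitDisc

/-! ### Taylor coefficients -/

theorem coeff_zero (f : ℂ → ℂ) : coeff f 0 = f 0 := by simp [coeff]

theorem coeff_congr {f g : ℂ → ℂ} (h : EqOn f g unitDisc) (n : ℕ) : coeff f n = coeff g n := by
  have : f =ᶠ[𝓝 0] g := eventually_of_mem unitDisc_mem_nhds_zero h
  rw [coeff, coeff, this.iteratedDeriv_eq]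

theorem coeff_deriv (f : ℂ → ℂ) (n : ℕ) : coeff (deriv f) n = (n + 1) * coeff f (n + 1) := by
  have h1 : ((n : ℂ) + 1) ≠ 0 := by exact_mod_cast n.succ_ne_zero
  rw [coeff, coeff, ← iteratedDeriv_succ', Nat.factorial_succ]
  push_cast
  field_simp

theorem coeff_mul {f g : ℂ → ℂ} (hf : AnalyticAt ℂ f 0) (hg : AnalyticAt ℂ g 0) (n : ℕ) :
    coeff (fun z => f z * g z) n =
      ∑ i ∈ Finset.range (n + 1), coeff f i * coeff g (n - i) := by
  have hf' : ContDiffAt ℂ n f 0 := hf.contDiffAt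
  have hg' : ContDiffAt ℂ n g 0 := hg.contDiffAt
  rw [coeff, iteratedDeriv_fun_mul hf' hg', Finset.sum_div]
  refine Finset.sum_congr rfl fun i hi => ?_
  have hi' : i ≤ n := Nat.lt_succ_iff.mp (Finset.mem_range.mp hi)
  have h := Nat.choose_mul_factorial_mul_factorial hi'
  have hc : (n.choose i : ℂ) * i.factorial * (n - i).factorial = n.factorial := by
    exact_mod_cast h
  have h1 : (i.factorial : ℂ) ≠ 0 := by exact_mod_cast i.factorial_ne_zero
  have h2 : ((n - i).factorial : ℂ) ≠ 0 := by exact_mod_cast (n - i).factorial_ne_zero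
  have h3 : (n.factorial : ℂ) ≠ 0 := by exact_mod_cast n.factorial_ne_zero
  rw [coeff, coeff]
  field_simp
  rw [← hc]
  ring

theorem coeff_id (n : ℕ) : coeff (fun z => z) n = if n = 1 then 1 else 0 := by
  rw [coeff, iteratedDeriv_fun_id_zero]
  split_ifs with h <;> simp [h]

theorem coeff_id_mul_succ {f : ℂ → ℂ} (hf : AnalyticAt ℂ f 0) (n : ℕ) :
    coeff (fun z => z * f z) (n + 1) = coeff f n := by
  rw [coeff_mul (f := fun z => z) analyticAt_id hf, Finset.sum_eq_single 1]
  · simp [coeff_id]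
  · intro i _ hi
    simp [coeff_id, hi]
  · simp

theorem coeff_id_mul_zero (f : ℂ → ℂ) : coeff (fun z => z * f z) 0 = 0 := by
  simp [coeff_zero]

theorem coeff_const (c : ℂ) (n : ℕ) : coeff (fun _ => c) n = if n = 0 then c else 0 := by
  rw [coeff, iteratedDeriv_const]
  split_ifs with h <;> simp [h]

theorem coeff_sub {f g : ℂ → ℂ} (hf : AnalyticAt ℂ f 0) (hg : AnalyticAt ℂ g 0) (n : ℕ) :
    coeff (fun z => f z - g z) n = coeff f n - coeff g n := by
  rw [coeff, coeff, coeff, iteratedDeriv_fun_sub hf.contDiffAt hg.contDiffAt, sub_div]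

theorem coeff_const_add {f : ℂ → ℂ} (c : ℂ) (hf : AnalyticAt ℂ f 0) (n : ℕ) :
    coeff (fun z => c + f z) n = (if n = 0 then c else 0) + coeff f n := by
  have : (fun z => c + f z) = fun z => f z - (fun _ => -c) z := by
    ext z; simp [add_comm]
  rw [this, coeff_sub hf analyticAt_const, coeff_const]
  split_ifs <;> ring

theorem coeff_const_mul (c : ℂ) (f : ℂ → ℂ) (n : ℕ) :
    coeff (fun z => c * f z) n = c * coeff f n := by
  rw [coeff, coeff, iteratedDeriv_const_mul_field, mul_div_assoc]

/-! ### The Schur algorithm -/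

/-- The difference of the squared norms is `(1 - |a|²)(1 - |b|²)`. -/
theorem norm_sub_le_norm_one_sub_conj_mul {a b : ℂ} (ha : ‖a‖ ≤ 1) (hb : ‖b‖ ≤ 1) :
    ‖b - a‖ ≤ ‖1 - conj a * b‖ := by
  have ha' : ‖a‖ ^ 2 ≤ 1 := pow_le_one₀ (norm_nonneg _) ha
  have hb' : ‖b‖ ^ 2 ≤ 1 := pow_le_one₀ (norm_nonneg _) hb
  refine le_of_sq_le_sq ?_ (norm_nonneg _)
  rw [← Complex.normSq_eq_norm_sq] at *
  rw [← Complex.normSq_eq_norm_sq] at *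
  simp only [Complex.normSq_apply, Complex.sub_re, Complex.sub_im, Complex.mul_re, Complex.mul_im,
    Complex.conj_re, Complex.conj_im, Complex.one_re, Complex.one_im] at *
  nlinarith [mul_nonneg (sub_nonneg.2 ha') (sub_nonneg.2 hb')]

/-- One step of the Schur algorithm for an analytic self-map of the closed disc. -/
theorem exists_schur_step {φ : ℂ → ℂ} (hφ : AnalyticOnNhd ℂ φ unitDisc)
    (hb : ∀ z ∈ unitDisc, ‖φ z‖ ≤ 1) :
    ∃ ψ : ℂ → ℂ, AnalyticOnNhd ℂ ψ unitDisc ∧ (∀ z ∈ unitDisc, ‖ψ z‖ ≤ 1) ∧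
      ∀ z ∈ unitDisc, φ z - φ 0 = z * (ψ z * (1 - conj (φ 0) * φ z)) := by
  have h0 : ‖φ 0‖ ≤ 1 := hb 0 zero_mem_unitDisc
  rcases h0.eq_or_lt with h1 | h1
  -- If `|φ 0| = 1`, the maximum principle makes `φ` constant.
  · refine ⟨fun _ => 0, analyticOnNhd_const, by simp, fun z hz => ?_⟩
    have hm : IsMaxOn (norm ∘ φ) unitDisc 0 := fun z hz => by
      simpa [h1] using hb z hz
    have := Complex.eqOn_of_isPreconnected_of_isMaxOn_norm
      (convex_ball (0 : ℂ) 1).isPreconnected isOpen_unitDisc hφ.differentiableOn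
      zero_mem_unitDisc hm hz
    simp [this]
  · have hne : ∀ z ∈ unitDisc, 1 - conj (φ 0) * φ z ≠ 0 := fun z hz h => by
      have h2 : ‖conj (φ 0) * φ z‖ < 1 := by
        rw [norm_mul, RCLike.norm_conj]
        nlinarith [hb z hz, norm_nonneg (φ 0), norm_nonneg (φ z)]
      rw [← sub_eq_zero.1 h, norm_one] at h2
      exact lt_irrefl _ h2
    set h : ℂ → ℂ := fun z => (φ z - φ 0) / (1 - conj (φ 0) * φ z) with hh
    have hd : DifferentiableOn ℂ h (ball 0 1) :=
      (hφ.differentiableOn.sub_const _).div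
        ((differentiableOn_const _).sub (hφ.differentiableOn.const_mul _)) hne
    have hh0 : h 0 = 0 := by simp [hh]
    have hmaps : MapsTo h (ball 0 1) (closedBall (h 0) 1) := fun z hz => by
      rw [hh0, mem_closedBall_zero_iff, hh, norm_div]
      exact div_le_one_of_le₀ (norm_sub_le_norm_one_sub_conj_mul h0 (hb z hz)) (norm_nonneg _)
    -- The quotient `h z / z`, bounded by 1 by the Schwarz lemma.
    refine ⟨dslope h 0, ?_, fun z hz => ?_, fun z hz => ?_⟩
    · exact ((Complex.differentiableOn_dslope unitDisc_mem_nhds_zero).2 hd).analyticOnNhd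
        isOpen_unitDisc
    · simpa using Complex.norm_dslope_le_div_of_mapsTo_ball hd hmaps hz
    · have := sub_smul_dslope h 0 z
      rw [sub_zero, smul_eq_mul, hh0, sub_zero] at this
      rw [← mul_assoc, this, hh, div_mul_cancel₀ _ (hne z hz)]

/-- Keeping the relation free of division gives a recursion: the right side involves only
coefficients of `φ` up to index `n`. -/
theorem coeff_schur_step {φ ψ : ℂ → ℂ} {c : ℂ} (hφ : AnalyticAt ℂ φ 0) (hψ : AnalyticAt ℂ ψ 0)
    (h : ∀ z ∈ unitDisc, φ z - φ 0 = z * (ψ z * (1 - c * φ z))) (n : ℕ) :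
    coeff φ (n + 1) =
      coeff ψ n - c * ∑ i ∈ Finset.range (n + 1), coeff ψ i * coeff φ (n - i) := by
  have h1 : coeff φ (n + 1) = coeff (fun z => φ z - φ 0) (n + 1) := by
    rw [coeff_sub hφ analyticAt_const, coeff_const]
    simp
  have h2 : AnalyticAt ℂ (fun z => c * (ψ z * φ z)) 0 := analyticAt_const.mul (hψ.mul hφ)
  have h3 : AnalyticAt ℂ (fun z => ψ z * (1 - c * φ z)) 0 :=
    hψ.mul (analyticAt_const.sub (analyticAt_const.mul hφ))
  rw [h1, coeff_congr (fun z hz => h z hz), coeff_id_mul_succ h3,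
    ← coeff_mul hψ hφ, ← coeff_const_mul, ← coeff_sub hψ h2]
  congr 1
  ext z
  ring

/-- Schur parameters of the first four Taylor coefficients of a Schwarz function. -/
theorem exists_schur_parameters {w : ℂ → ℂ} (hw : AnalyticOnNhd ℂ w unitDisc) (hw0 : w 0 = 0)
    (hb : ∀ z ∈ unitDisc, ‖w z‖ ≤ 1) :
    ∃ c x y ζ : ℂ, ‖c‖ ≤ 1 ∧ ‖x‖ ≤ 1 ∧ ‖y‖ ≤ 1 ∧ ‖ζ‖ ≤ 1 ∧
      coeff w 1 = c ∧
      coeff w 2 = (1 - c * conj c) * x ∧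
      coeff w 3 = (1 - c * conj c) * (-conj c * x ^ 2 + (1 - x * conj x) * y) ∧
      coeff w 4 = (1 - c * conj c) * (conj c ^ 2 * x ^ 3
        - (1 - x * conj x) * (2 * conj c * x * y + conj x * y ^ 2)
        + (1 - x * conj x) * (1 - y * conj y) * ζ) := by
  obtain ⟨φ₁, ha₁, hb₁, h₁⟩ := exists_schur_step hw hb
  obtain ⟨φ₂, ha₂, hb₂, h₂⟩ := exists_schur_step ha₁ hb₁
  obtain ⟨φ₃, ha₃, hb₃, h₃⟩ := exists_schur_step ha₂ hb₂
  obtain ⟨φ₄, ha₄, hb₄, h₄⟩ := exists_schur_step ha₃ hb₃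
  have m := zero_mem_unitDisc
  have e₁ := coeff_schur_step (hw 0 m) (ha₁ 0 m) h₁
  have e₂ := coeff_schur_step (ha₁ 0 m) (ha₂ 0 m) h₂
  have e₃ := coeff_schur_step (ha₂ 0 m) (ha₃ 0 m) h₃
  have e₄ := coeff_schur_step (ha₃ 0 m) (ha₄ 0 m) h₄
  simp only [hw0, map_zero, zero_mul, sub_zero] at e₁
  have e₂₀ := e₂ 0
  have e₂₁ := e₂ 1
  have e₂₂ := e₂ 2
  have e₃₀ := e₃ 0
  have e₃₁ := e₃ 1
  have e₄₀ := e₄ 0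
  simp only [Finset.sum_range_succ, Finset.sum_range_zero, zero_add, Nat.reduceSub, Nat.reduceAdd,
    coeff_zero, Nat.sub_self] at e₂₀ e₂₁ e₂₂ e₃₀ e₃₁ e₄₀
  refine ⟨φ₁ 0, φ₂ 0, φ₃ 0, φ₄ 0, hb₁ 0 m, hb₂ 0 m, hb₃ 0 m, hb₄ 0 m, ?_, ?_, ?_, ?_⟩
  · rw [e₁ 0, coeff_zero]
  · rw [e₁ 1, e₂₀]; ring
  · rw [e₁ 2, e₂₁, e₂₀, e₃₀]; ring
  · rw [e₁ 3, e₂₂, e₂₁, e₂₀, e₃₁, e₃₀, e₄₀]; ring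

/-! ### The inverse hyperbolic sine and the class `S*_ρ` -/

/-- The principal branch of `√(1 + z ^ 2)`. -/
noncomputable def sqrtOneAddSq (z : ℂ) : ℂ := (1 + z ^ 2) ^ (1 / 2 : ℂ)

theorem one_add_sq_mem_slitPlane {z : ℂ} (hz : z ∈ unitDisc) : 1 + z ^ 2 ∈ Complex.slitPlane := by
  refine Complex.mem_slitPlane_iff.2 (Or.inl ?_)
  have h : ‖z ^ 2‖ < 1 := by
    rw [norm_pow]
    exact pow_lt_one₀ (norm_nonneg _) (mem_unitDisc.1 hz) two_ne_zero
  have := (abs_le.1 (Complex.abs_re_le_norm (z ^ 2))).1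
  rw [Complex.add_re, Complex.one_re]
  linarith

theorem sqrtOneAddSq_sq (z : ℂ) : sqrtOneAddSq z ^ 2 = 1 + z ^ 2 := by
  rw [sqrtOneAddSq, one_div]
  exact Complex.cpow_nat_inv_pow _ two_ne_zero

theorem re_sqrtOneAddSq_pos {z : ℂ} (hz : z ∈ unitDisc) : 0 < (sqrtOneAddSq z).re := by
  have h := one_add_sq_mem_slitPlane hz
  rw [sqrtOneAddSq, Complex.cpow_def_of_ne_zero (Complex.slitPlane_ne_zero h), Complex.exp_re]
  refine mul_pos (Real.exp_pos _) (Real.cos_pos_of_mem_Ioo ?_)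
  have h1 : (Complex.log (1 + z ^ 2) * (1 / 2)).im = Complex.arg (1 + z ^ 2) / 2 := by
    simp [Complex.mul_im, Complex.log_im]
    ring
  have h2 := Complex.neg_pi_lt_arg (1 + z ^ 2)
  have h3 := (Complex.arg_le_pi (1 + z ^ 2)).lt_of_ne (Complex.slitPlane_arg_ne_pi h)
  rw [h1]
  constructor <;> linarith

theorem sqrtOneAddSq_ne_zero {z : ℂ} (hz : z ∈ unitDisc) : sqrtOneAddSq z ≠ 0 := fun h => by
  have := re_sqrtOneAddSq_pos hz
  simp [h] at this

/-- With `S = √(1 + z²)`, one has `(S + z)(S - z) = 1`. If `S + z` were a nonpositive real, so would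
be its inverse `S - z`, against `Re S > 0`. -/
theorem add_sqrtOneAddSq_mem_slitPlane {z : ℂ} (hz : z ∈ unitDisc) :
    z + sqrtOneAddSq z ∈ Complex.slitPlane := by
  by_contra hcon
  rw [Complex.mem_slitPlane_iff, not_or, not_lt, not_not] at hcon
  obtain ⟨hre, him⟩ := hcon
  have hS := re_sqrtOneAddSq_pos hz
  have hprod : (z + sqrtOneAddSq z) * (sqrtOneAddSq z - z) = 1 := by
    linear_combination sqrtOneAddSq_sq z
  have h1 := congrArg Complex.re hprod
  rw [Complex.mul_re, him, Complex.one_re, zero_mul, sub_zero, Complex.sub_re] at h1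
  rw [Complex.add_re] at hre h1
  nlinarith

theorem hasDerivAt_sqrtOneAddSq {z : ℂ} (hz : z ∈ unitDisc) :
    HasDerivAt sqrtOneAddSq (z / sqrtOneAddSq z) z := by
  have h := ((hasDerivAt_pow 2 z).const_add (1 : ℂ)).cpow_const (c := (1 / 2 : ℂ))
    (one_add_sq_mem_slitPlane hz)
  have hne := Complex.slitPlane_ne_zero (one_add_sq_mem_slitPlane hz)
  have hS := sqrtOneAddSq_ne_zero hz
  have hpow : (1 + z ^ 2) ^ (1 / 2 - 1 : ℂ) = sqrtOneAddSq z / sqrtOneAddSq z ^ 2 := by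
    rw [Complex.cpow_sub _ _ hne, Complex.cpow_one, sqrtOneAddSq_sq, sqrtOneAddSq]
  rw [hpow] at h
  refine h.congr_deriv ?_
  generalize sqrtOneAddSq z = S at hS
  push_cast
  field_simp

theorem hasDerivAt_arcsinh {z : ℂ} (hz : z ∈ unitDisc) :
    HasDerivAt arcsinh (1 / sqrtOneAddSq z) z := by
  have h := ((hasDerivAt_id z).add (hasDerivAt_sqrtOneAddSq hz)).clog
    (add_sqrtOneAddSq_mem_slitPlane hz)
  refine h.congr_deriv ?_
  have hne := Complex.slitPlane_ne_zero (add_sqrtOneAddSq_mem_slitPlane hz)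
  have hS := sqrtOneAddSq_ne_zero hz
  rw [Pi.add_apply, id_eq, div_eq_div_iff hne hS]
  field_simp
  ring

theorem analyticOnNhd_arcsinh : AnalyticOnNhd ℂ arcsinh unitDisc :=
  DifferentiableOn.analyticOnNhd
    (fun _ hz => (hasDerivAt_arcsinh hz).differentiableAt.differentiableWithinAt) isOpen_unitDisc

theorem analyticOnNhd_sqrtOneAddSq : AnalyticOnNhd ℂ sqrtOneAddSq unitDisc :=
  DifferentiableOn.analyticOnNhd
    (fun _ hz => (hasDerivAt_sqrtOneAddSq hz).differentiableAt.differentiableWithinAt)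
    isOpen_unitDisc

theorem sqrtOneAddSq_zero : sqrtOneAddSq 0 = 1 := by simp [sqrtOneAddSq]

theorem arcsinh_zero : arcsinh 0 = 0 := by simp [arcsinh]

/-- No power series of `arcsinh` is needed: `A = arcsinh ∘ w` and `S = √(1 + w²)` satisfy `w' = S
A'` and `S' = w A'`, which determine the coefficients recursively. -/
theorem coeff_arcsinh_comp {w : ℂ → ℂ} (hw : AnalyticOnNhd ℂ w unitDisc) (hw0 : w 0 = 0)
    (hb : MapsTo w unitDisc unitDisc) :
    coeff (arcsinh ∘ w) 1 = coeff w 1 ∧ coeff (arcsinh ∘ w) 2 = coeff w 2 ∧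
      coeff (arcsinh ∘ w) 3 = coeff w 3 - coeff w 1 ^ 3 / 6 ∧
      coeff (arcsinh ∘ w) 4 = coeff w 4 - coeff w 1 ^ 2 * coeff w 2 / 2 := by
  have m := zero_mem_unitDisc
  have hA : AnalyticOnNhd ℂ (arcsinh ∘ w) unitDisc := analyticOnNhd_arcsinh.comp hw hb
  have hS : AnalyticOnNhd ℂ (sqrtOneAddSq ∘ w) unitDisc := analyticOnNhd_sqrtOneAddSq.comp hw hb
  have dA : ∀ z ∈ unitDisc, deriv (arcsinh ∘ w) z = 1 / sqrtOneAddSq (w z) * deriv w z :=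
    fun z hz => ((hasDerivAt_arcsinh (hb hz)).comp z (hw z hz).differentiableAt.hasDerivAt).deriv
  have dS : ∀ z ∈ unitDisc,
      deriv (sqrtOneAddSq ∘ w) z = w z / sqrtOneAddSq (w z) * deriv w z := fun z hz =>
    ((hasDerivAt_sqrtOneAddSq (hb hz)).comp z (hw z hz).differentiableAt.hasDerivAt).deriv
  have e₁ : EqOn (deriv w) (fun z => (sqrtOneAddSq ∘ w) z * deriv (arcsinh ∘ w) z) unitDisc := by
    intro z hz
    have := sqrtOneAddSq_ne_zero (hb hz)
    simp only [dA z hz, Function.comp_apply]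
    field_simp
  have e₂ : EqOn (deriv (sqrtOneAddSq ∘ w)) (fun z => w z * deriv (arcsinh ∘ w) z) unitDisc := by
    intro z hz
    simp only [dA z hz, dS z hz]
    ring
  have r₁ : ∀ n, _ := fun n => (coeff_deriv w n).symm.trans
    ((coeff_congr e₁ n).trans (coeff_mul (hS 0 m) (hA.deriv 0 m) n))
  have r₂ : ∀ n, _ := fun n => (coeff_deriv (sqrtOneAddSq ∘ w) n).symm.trans
    ((coeff_congr e₂ n).trans (coeff_mul (hw 0 m) (hA.deriv 0 m) n))
  have w0 : coeff w 0 = 0 := by rw [coeff_zero, hw0]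
  have s0 : coeff (sqrtOneAddSq ∘ w) 0 = 1 := by
    rw [coeff_zero, Function.comp_apply, hw0, sqrtOneAddSq_zero]
  have p₀ := r₁ 0
  have p₁ := r₁ 1
  have p₂ := r₁ 2
  have p₃ := r₁ 3
  have q₀ := r₂ 0
  have q₁ := r₂ 1
  have q₂ := r₂ 2
  simp only [Finset.sum_range_succ, Finset.sum_range_zero, zero_add, Nat.reduceSub, Nat.reduceAdd,
    Nat.sub_self, coeff_deriv, w0, s0, Nat.cast_zero, Nat.cast_one, Nat.cast_ofNat, zero_mul,
    one_mul] at p₀ p₁ p₂ p₃ q₀ q₁ q₂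
  have a₁ : coeff (arcsinh ∘ w) 1 = coeff w 1 := p₀.symm
  rw [q₀] at p₁ p₂ p₃
  have a₂ : coeff (arcsinh ∘ w) 2 = coeff w 2 := by linear_combination -p₁ / 2
  rw [a₁] at p₂ p₃ q₁ q₂
  rw [a₂] at p₃ q₂
  refine ⟨a₁, a₂, ?_, ?_⟩
  · linear_combination -p₂ / 3 - coeff w 1 * q₁ / 6
  · linear_combination -p₃ / 4 - coeff w 1 * q₂ / 12 - coeff w 2 * q₁ / 4

theorem coeff_one_of_normalizedAnalytic {f : ℂ → ℂ} (hf : NormalizedAnalytic f) :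
    coeff f 1 = 1 := by
  simp [coeff, hf.2.2]

theorem hankelDet_three_one {f : ℂ → ℂ} (hf : NormalizedAnalytic f) :
    hankelDet 3 1 f = 2 * coeff f 2 * coeff f 3 * coeff f 4 - coeff f 3 ^ 3 - coeff f 4 ^ 2
      - coeff f 2 ^ 2 * coeff f 5 + coeff f 3 * coeff f 5 := by
  rw [hankelDet, Matrix.det_fin_three]
  simp [coeff_one_of_normalizedAnalytic hf]
  ring

/-- The determinant `H_{3,1}(f)` in terms of the Schwarz function `w` with
`z f' / f = 1 + arcsinh ∘ w`. -/
theorem hankelDet_eq_of_schwarz {f w : ℂ → ℂ} (hf : NormalizedAnalytic f)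
    (hf0 : ∀ z ∈ unitDisc, z ≠ 0 → f z ≠ 0) (hw : AnalyticOnNhd ℂ w unitDisc) (hw0 : w 0 = 0)
    (hb : MapsTo w unitDisc unitDisc)
    (h : ∀ z ∈ unitDisc, starQuotient f z = 1 + arcsinh (w z)) :
    144 * hankelDet 3 1 f = 18 * (coeff w 2 - coeff w 1 ^ 2) * coeff w 4 - 16 * coeff w 3 ^ 2
      + 24 * coeff w 1 * coeff w 2 * coeff w 3 + 40 / 3 * coeff w 1 ^ 3 * coeff w 3
      - 9 * coeff w 2 ^ 3 - 18 * coeff w 1 ^ 2 * coeff w 2 ^ 2 + 8 * coeff w 1 ^ 4 * coeff w 2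
      - 25 / 9 * coeff w 1 ^ 6 := by
  have m := zero_mem_unitDisc
  have hA : AnalyticOnNhd ℂ (arcsinh ∘ w) unitDisc := analyticOnNhd_arcsinh.comp hw hb
  have e : EqOn (fun z => z * deriv f z) (fun z => f z * (1 + (arcsinh ∘ w) z)) unitDisc := by
    intro z hz
    rcases eq_or_ne z 0 with rfl | hz0
    · simp [hf.2.1]
    · have := h z hz
      rw [starQuotient, if_neg hz0, div_eq_iff (hf0 z hz hz0)] at this
      simp only [Function.comp_apply, this, mul_comm]
  have hA1 : AnalyticAt ℂ (fun z => 1 + (arcsinh ∘ w) z) 0 := analyticAt_const.add (hA 0 m)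
  have r : ∀ n, _ := fun n => (coeff_id_mul_succ (hf.1.deriv 0 m) n).symm.trans
    ((coeff_congr e (n + 1)).trans (coeff_mul (hf.1 0 m) hA1 (n + 1)))
  obtain ⟨a₁, a₂, a₃, a₄⟩ := coeff_arcsinh_comp hw hw0 hb
  have a₀ : coeff (arcsinh ∘ w) 0 = 0 := by
    rw [coeff_zero, Function.comp_apply, hw0, arcsinh_zero]
  have f₀ : coeff f 0 = 0 := by rw [coeff_zero, hf.2.1]
  have f₁ := coeff_one_of_normalizedAnalytic hf
  have r₁ := r 1
  have r₂ := r 2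
  have r₃ := r 3
  have r₄ := r 4
  simp only [coeff_deriv, coeff_const_add _ (hA 0 m), Finset.sum_range_succ,
    Finset.sum_range_zero, zero_add, Nat.reduceSub, Nat.reduceAdd, Nat.sub_self, Nat.cast_one,
    Nat.cast_ofNat, f₀, f₁, a₀, a₁, a₂, a₃, a₄, zero_mul, one_mul,
    OfNat.ofNat_ne_zero, one_ne_zero, if_true, if_false, add_zero, mul_one] at r₁ r₂ r₃ r₄
  have g₂ : coeff f 2 = coeff w 1 := by linear_combination r₁
  have g₃ : coeff f 3 = (coeff w 2 + coeff w 1 ^ 2) / 2 := by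
    rw [g₂] at r₂; linear_combination r₂ / 2
  have g₄ : coeff f 4 = (coeff w 3 - coeff w 1 ^ 3 / 6 + coeff w 1 * coeff w 2
      + coeff w 1 * (coeff w 2 + coeff w 1 ^ 2) / 2) / 3 := by
    rw [g₂, g₃] at r₃; linear_combination r₃ / 3
  have g₅ : coeff f 5 = (coeff w 4 - coeff w 1 ^ 2 * coeff w 2 / 2
      + coeff w 1 * (coeff w 3 - coeff w 1 ^ 3 / 6) + (coeff w 2 + coeff w 1 ^ 2) / 2 * coeff w 2
      + (coeff w 3 - coeff w 1 ^ 3 / 6 + coeff w 1 * coeff w 2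
        + coeff w 1 * (coeff w 2 + coeff w 1 ^ 2) / 2) / 3 * coeff w 1) / 4 := by
    rw [g₂, g₃, g₄] at r₄; linear_combination r₄ / 4
  rw [hankelDet_three_one hf, g₂, g₃, g₄, g₅]
  ring

/-! ### The extremal function -/

theorem exists_extremal_eq : ∃ F : ℂ → ℂ, F 0 = 0 ∧
    (∀ z ∈ unitDisc, HasDerivAt F (arcsinh (z ^ 3) / z) z) ∧
    ∀ z ∈ unitDisc, extremal z = z * Complex.exp (F z) := by
  set g : ℂ → ℂ := fun z => arcsinh (z ^ 3) / z with hg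
  have hcube : MapsTo (fun z : ℂ => z ^ 3) unitDisc unitDisc := fun z hz => by
    rw [mem_unitDisc] at *
    rw [norm_pow]
    exact pow_lt_one₀ (norm_nonneg _) hz three_ne_zero
  have hh : DifferentiableOn ℂ (fun z : ℂ => arcsinh (z ^ 3)) unitDisc :=
    analyticOnNhd_arcsinh.differentiableOn.comp (by fun_prop) hcube
  -- At `0` the convention `0 / 0 = 0` gives the correct value, since `arcsinh (z ^ 3)` has zero
  -- derivative there.
  have hg_eq : dslope (fun z : ℂ => arcsinh (z ^ 3)) 0 = g := by
    ext z
    rcases eq_or_ne z 0 with rfl | hz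
    · rw [dslope_same]
      have h := (hasDerivAt_arcsinh (z := (0 : ℂ) ^ 3) (by simp [mem_unitDisc])).comp 0
        (hasDerivAt_pow 3 (0 : ℂ))
      simpa [hg, Function.comp_def] using h.deriv
    · rw [dslope_of_ne _ hz, slope_def_field]
      simp [hg, arcsinh_zero]
  have hgd : DifferentiableOn ℂ g unitDisc := by
    rw [← hg_eq]
    exact (Complex.differentiableOn_dslope unitDisc_mem_nhds_zero).2 hh
  obtain ⟨F, hF⟩ := hgd.isExactOn_ball
  refine ⟨fun z => F z - F 0, sub_self _, fun z hz => (hF z hz).sub_const _, fun z hz => ?_⟩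
  have hmem : ∀ s ∈ uIcc (0 : ℝ) 1, (s : ℂ) * z ∈ unitDisc := fun s hs => by
    rw [uIcc_of_le zero_le_one] at hs
    rw [mem_unitDisc] at *
    rw [norm_mul, Complex.norm_real, Real.norm_of_nonneg hs.1]
    exact (mul_le_of_le_one_left (norm_nonneg _) hs.2).trans_lt hz
  have hderiv : ∀ s ∈ uIcc (0 : ℝ) 1,
      HasDerivAt (fun s : ℝ => F ((s : ℂ) * z)) (g ((s : ℂ) * z) * z) s := fun s hs => by
    have h1 : HasDerivAt (fun s : ℝ => (s : ℂ) * z) z s := by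
      simpa using (Complex.ofRealCLM.hasDerivAt (x := s)).mul_const z
    exact (hF _ (hmem s hs)).comp s h1
  have hcont : ContinuousOn (fun s : ℝ => g ((s : ℂ) * z) * z) (uIcc 0 1) :=
    (hgd.continuousOn.comp (by fun_prop) hmem).mul continuousOn_const
  have hint := intervalIntegral.integral_eq_sub_of_hasDerivAt hderiv hcont.intervalIntegrable
  simp only [Complex.ofReal_one, one_mul, Complex.ofReal_zero, zero_mul] at hint
  simp only [extremal, ← hint, hg]

theorem extremal_spec : NormalizedAnalytic extremal ∧
    (∀ z ∈ unitDisc, z ≠ 0 → extremal z ≠ 0) ∧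
    ∀ z ∈ unitDisc, starQuotient extremal z = 1 + arcsinh (z ^ 3) := by
  obtain ⟨F, hF0, hF, he⟩ := exists_extremal_eq
  have hd : ∀ z ∈ unitDisc, HasDerivAt extremal
      (Complex.exp (F z) + z * (Complex.exp (F z) * (arcsinh (z ^ 3) / z))) z := fun z hz => by
    have h := (hasDerivAt_id z).mul (hF z hz).cexp
    refine (h.congr_of_eventuallyEq
      (eventually_of_mem (isOpen_unitDisc.mem_nhds hz) he)).congr_deriv ?_
    simp
  refine ⟨⟨?_, ?_, ?_⟩, fun z hz hz0 => ?_, fun z hz => ?_⟩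
  · exact DifferentiableOn.analyticOnNhd
      (fun z hz => (hd z hz).differentiableAt.differentiableWithinAt) isOpen_unitDisc
  · simp [extremal]
  · rw [(hd 0 zero_mem_unitDisc).deriv]
    simp [hF0]
  · rw [he z hz]
    exact mul_ne_zero hz0 (Complex.exp_ne_zero _)
  · rcases eq_or_ne z 0 with rfl | hz0
    · simp [starQuotient, arcsinh_zero]
    · have := Complex.exp_ne_zero (F z)
      rw [starQuotient, if_neg hz0, (hd z hz).deriv, he z hz]
      field_simp

/-! ### The real inequality -/

/-- A binary cubic form is nonnegative on the segment `t + u = 1` once its Bernstein coefficients,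
after elevating the degree to six, are nonnegative. -/
theorem cubic_form_nonneg {t u a b c d : ℝ} (ht : 0 ≤ t) (hu : 0 ≤ u) (htu : t + u = 1)
    (h₁ : 0 ≤ a) (h₂ : 0 ≤ 3 * a + b) (h₃ : 0 ≤ 3 * a + 3 * b + c)
    (h₄ : 0 ≤ a + 3 * b + 3 * c + d) (h₅ : 0 ≤ b + 3 * c + 3 * d) (h₆ : 0 ≤ c + 3 * d)
    (h₇ : 0 ≤ d) : 0 ≤ a * u ^ 3 + b * u ^ 2 * t + c * u * t ^ 2 + d * t ^ 3 := by
  have h : a * u ^ 3 + b * u ^ 2 * t + c * u * t ^ 2 + d * t ^ 3 =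
      a * u ^ 6 + (3 * a + b) * u ^ 5 * t + (3 * a + 3 * b + c) * u ^ 4 * t ^ 2
        + (a + 3 * b + 3 * c + d) * u ^ 3 * t ^ 3 + (b + 3 * c + 3 * d) * u ^ 2 * t ^ 4
        + (c + 3 * d) * u * t ^ 5 + d * t ^ 6 := by
    obtain rfl : u = 1 - t := by linarith
    ring
  rw [h]
  positivity

/-- The part of the majorant of `144 |H_{3,1}|` independent of the third and fourth Schur
parameters; here `c` and `x` are the moduli of the first two. -/
noncomputable def majorantConst (c x : ℝ) : ℝ :=
  2 * (1 - c ^ 2) ^ 2 * c ^ 2 * x ^ 4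
    + (18 * (1 - c ^ 2) * c ^ 4 + 24 * c ^ 2 * (1 - c ^ 2) ^ 2 + 9 * (1 - c ^ 2) ^ 3) * x ^ 3
    + (40 / 3 * c ^ 4 * (1 - c ^ 2) + 18 * c ^ 2 * (1 - c ^ 2) ^ 2) * x ^ 2
    + 8 * c ^ 4 * (1 - c ^ 2) * x + 25 / 9 * c ^ 6

/-- The coefficient of the modulus of the third Schur parameter in the majorant. -/
noncomputable def majorantLin (c x : ℝ) : ℝ :=
  (1 - c ^ 2) * (1 - x ^ 2) * c *
    (4 * (1 - c ^ 2) * x ^ 2 + (36 * c ^ 2 + 24 * (1 - c ^ 2)) * x + 40 / 3 * c ^ 2)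

/-- The coefficient of the squared modulus of the third Schur parameter in the majorant. -/
noncomputable def majorantQuad (c x : ℝ) : ℝ :=
  (1 - c ^ 2) * (1 - x ^ 2) * (16 * (1 - c ^ 2) + 2 * (1 - c ^ 2) * x ^ 2 + 18 * c ^ 2 * x)

/-- The coefficient of the modulus of the fourth Schur parameter in the majorant. -/
noncomputable def majorantLast (c x : ℝ) : ℝ :=
  18 * (1 - c ^ 2) * (1 - x ^ 2) * ((1 - c ^ 2) * x + c ^ 2)

variable {c x y : ℝ}

theorem majorant_add_quad_le (hc : 0 ≤ c) (hc1 : c ≤ 1) (hx : 0 ≤ x) (hx1 : x ≤ 1) :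
    majorantConst c x + majorantLin c x + majorantQuad c x ≤ 16 := by
  have hu : 0 ≤ 1 - c ^ 2 := by nlinarith
  have hv : 0 ≤ 1 - x ^ 2 := by nlinarith
  have hy : 0 ≤ 1 - x := by linarith
  have hxy := mul_nonneg hx hy
  -- The last factor is `5/6 * (c - 3/5)²`: a bound for `c` that is linear in `c²` and `1 - c²`.
  have h₁ : 0 ≤ (1 - c ^ 2) * (1 - x ^ 2) *
      (4 * (1 - c ^ 2) * x ^ 2 + 36 * c ^ 2 * x + 40 / 3 * c ^ 2) *
        (17 / 15 * c ^ 2 + 3 / 10 * (1 - c ^ 2) - c) := by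
    refine mul_nonneg (by positivity) ?_
    nlinarith [sq_nonneg (c - 3 / 5)]
  -- The term `24 c x` needs its own AM-GM bound: the previous one would leave a term linear in `x`
  -- at `c = 0`, violating the bound 16 near the equality point `c = x = 0`.
  have h₂ : 0 ≤ (1 - c ^ 2) ^ 2 * (1 - x ^ 2) *
      (12 * (6 / 5 * c ^ 2 + x ^ 2 / (6 / 5)) - 24 * c * x) := by
    refine mul_nonneg (by positivity) ?_
    nlinarith [sq_nonneg (6 / 5 * c - x)]
  have h₃ := cubic_form_nonneg (t := c ^ 2) (u := 1 - c ^ 2)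
    (a := 16 - (9 * x ^ 3 + (1 - x ^ 2) * (16 + 66 / 5 * x ^ 2)))
    (b := 48 - (2 * x ^ 4 + 24 * x ^ 3 + 18 * x ^ 2
      + (1 - x ^ 2) * (172 / 5 + 144 / 5 * x + 248 / 15 * x ^ 2)))
    (c := 48 - (18 * x ^ 3 + 40 / 3 * x ^ 2 + 8 * x
      + (1 - x ^ 2) * (294 / 5 * x + 136 / 9)))
    (d := 16 - 25 / 9) (by positivity) hu (by ring)
    (by nlinarith [mul_nonneg (sq_nonneg x) (sq_nonneg (x - 9 / 26)), sq_nonneg x])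
    (by nlinarith [mul_nonneg hxy (sq_nonneg x), mul_nonneg hxy (sq_nonneg (x - 1)),
          sq_nonneg (x ^ 2 - x), sq_nonneg (x ^ 2 - 7 / 10 * x),
          mul_nonneg hxy (sq_nonneg (x - 7 / 10)), sq_nonneg (x - 7 / 10)])
    (by nlinarith [mul_nonneg hxy (sq_nonneg x), mul_nonneg hxy (sq_nonneg (x - 1)),
          sq_nonneg (x ^ 2 - x), sq_nonneg (x ^ 2 - 7 / 10 * x),
          mul_nonneg hxy (sq_nonneg (x - 7 / 10)), sq_nonneg (x - 7 / 10)])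
    (by nlinarith [mul_nonneg hxy (sq_nonneg x), mul_nonneg hxy (sq_nonneg (x - 1)),
          sq_nonneg (x ^ 2 - x), sq_nonneg (x ^ 2 - 7 / 10 * x),
          mul_nonneg hxy (sq_nonneg (x - 7 / 10)), sq_nonneg (x - 7 / 10)])
    (by nlinarith [mul_nonneg hxy (sq_nonneg x), mul_nonneg hxy (sq_nonneg (x - 1)),
          sq_nonneg (x ^ 2 - x)])
    (by nlinarith [mul_nonneg hxy (sq_nonneg x), mul_nonneg hxy (sq_nonneg (x - 1)),
          sq_nonneg (x ^ 2 - x)])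
    (by norm_num)
  rw [majorantConst, majorantLin, majorantQuad]
  linear_combination h₁ + h₂ + h₃

theorem majorant_add_last_le (hc : 0 ≤ c) (hc1 : c ≤ 1) (hx : 0 ≤ x) (hx1 : x ≤ 1) :
    majorantConst c x + majorantLin c x + majorantLast c x ≤ 16 := by
  have hu : 0 ≤ 1 - c ^ 2 := by nlinarith
  have hv : 0 ≤ 1 - x ^ 2 := by nlinarith
  have hy : 0 ≤ 1 - x := by linarith
  have hxy := mul_nonneg hx hy
  have h₁ : 0 ≤ (1 - c ^ 2) * (1 - x ^ 2) *
      (4 * (1 - c ^ 2) * x ^ 2 + (36 * c ^ 2 + 24 * (1 - c ^ 2)) * x + 40 / 3 * c ^ 2) *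
        (17 / 15 * c ^ 2 + 3 / 10 * (1 - c ^ 2) - c) := by
    refine mul_nonneg (by positivity) ?_
    nlinarith [sq_nonneg (c - 3 / 5)]
  have h₂ := cubic_form_nonneg (t := c ^ 2) (u := 1 - c ^ 2)
    (a := 16 - (9 * x ^ 3 + (1 - x ^ 2) * (126 / 5 * x + 6 / 5 * x ^ 2)))
    (b := 48 - (2 * x ^ 4 + 24 * x ^ 3 + 18 * x ^ 2
      + (1 - x ^ 2) * (22 + 56 * x + 68 / 15 * x ^ 2)))
    (c := 48 - (18 * x ^ 3 + 40 / 3 * x ^ 2 + 8 * x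
      + (1 - x ^ 2) * (18 + 204 / 5 * x + 136 / 9)))
    (d := 16 - 25 / 9) (by positivity) hu (by ring)
    (by nlinarith [mul_nonneg hxy (sq_nonneg x), mul_nonneg hxy (sq_nonneg (x - 1)),
          sq_nonneg (x ^ 2 - x), sq_nonneg (x ^ 2 - 7 / 10 * x),
          mul_nonneg hxy (sq_nonneg (x - 7 / 10)), sq_nonneg (x - 7 / 10)])
    (by nlinarith [mul_nonneg hxy (sq_nonneg x), mul_nonneg hxy (sq_nonneg (x - 1)),
          sq_nonneg (x ^ 2 - x), sq_nonneg (x ^ 2 - 7 / 10 * x),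
          mul_nonneg hxy (sq_nonneg (x - 7 / 10)), sq_nonneg (x - 7 / 10)])
    (by nlinarith [mul_nonneg hxy (sq_nonneg x), mul_nonneg hxy (sq_nonneg (x - 1)),
          sq_nonneg (x ^ 2 - x), sq_nonneg (x ^ 2 - 7 / 10 * x),
          mul_nonneg hxy (sq_nonneg (x - 7 / 10)), sq_nonneg (x - 7 / 10)])
    (by nlinarith [mul_nonneg hxy (sq_nonneg x), mul_nonneg hxy (sq_nonneg (x - 1)),
          sq_nonneg (x ^ 2 - x), sq_nonneg (x ^ 2 - 7 / 10 * x),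
          mul_nonneg hxy (sq_nonneg (x - 7 / 10)), sq_nonneg (x - 7 / 10)])
    (by nlinarith [mul_nonneg hxy (sq_nonneg x), mul_nonneg hxy (sq_nonneg (x - 1)),
          sq_nonneg (x ^ 2 - x)])
    (by nlinarith [mul_nonneg hxy (sq_nonneg x), mul_nonneg hxy (sq_nonneg (x - 1)),
          sq_nonneg (x ^ 2 - x)])
    (by norm_num)
  rw [majorantConst, majorantLin, majorantLast]
  linear_combination h₁ + h₂

theorem majorant_le (hc : 0 ≤ c) (hc1 : c ≤ 1) (hx : 0 ≤ x) (hx1 : x ≤ 1) (hy : 0 ≤ y)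
    (hy1 : y ≤ 1) :
    majorantConst c x + majorantLin c x * y + majorantQuad c x * y ^ 2
      + majorantLast c x * (1 - y ^ 2) ≤ 16 := by
  have hu : 0 ≤ 1 - c ^ 2 := by nlinarith
  have hv : 0 ≤ 1 - x ^ 2 := by nlinarith
  have hl : 0 ≤ majorantLin c x := by rw [majorantLin]; positivity
  have hy2 : 0 ≤ 1 - y ^ 2 := by nlinarith
  have h₁ := mul_le_mul_of_nonneg_right (majorant_add_quad_le hc hc1 hx hx1) (sq_nonneg y)
  have h₂ := mul_le_mul_of_nonneg_right (majorant_add_last_le hc hc1 hx hx1) hy2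
  have h₃ := mul_le_of_le_one_right hl hy1
  linear_combination h₁ + h₂ + h₃

/-! ### The bound in terms of the Schur parameters -/

/-- Like terms are collected by powers of `y` and `ζ` before taking norms, so that cancellations
such as `18 - 16 = 2` and `36 - 32 = 4` between `c₂ c₄` and `c₃²` are not lost. -/
theorem norm_hankel_schur_le {c x y ζ c₂ c₃ c₄ : ℂ} (hc : ‖c‖ ≤ 1) (hx : ‖x‖ ≤ 1) (hy : ‖y‖ ≤ 1)
    (hζ : ‖ζ‖ ≤ 1) (h₂ : c₂ = (1 - c * conj c) * x)
    (h₃ : c₃ = (1 - c * conj c) * (-conj c * x ^ 2 + (1 - x * conj x) * y))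
    (h₄ : c₄ = (1 - c * conj c) * (conj c ^ 2 * x ^ 3
        - (1 - x * conj x) * (2 * conj c * x * y + conj x * y ^ 2)
        + (1 - x * conj x) * (1 - y * conj y) * ζ)) :
    ‖18 * (c₂ - c ^ 2) * c₄ - 16 * c₃ ^ 2 + 24 * c * c₂ * c₃ + 40 / 3 * c ^ 3 * c₃ - 9 * c₂ ^ 3
      - 18 * c ^ 2 * c₂ ^ 2 + 8 * c ^ 4 * c₂ - 25 / 9 * c ^ 6‖ ≤ 16 := by
  have norm_defect : ∀ {a : ℂ}, ‖a‖ ≤ 1 → ‖1 - a * conj a‖ = 1 - ‖a‖ ^ 2 := fun {a} ha => by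
    have : 1 - a * conj a = ((1 - ‖a‖ ^ 2 : ℝ) : ℂ) := by rw [Complex.mul_conj']; push_cast; rfl
    rw [this, Complex.norm_real, Real.norm_of_nonneg]
    exact sub_nonneg.2 (pow_le_one₀ (norm_nonneg a) ha)
  have hu := norm_defect hc
  have hv := norm_defect hx
  have hY := norm_defect hy
  subst h₂ h₃ h₄
  set u : ℂ := 1 - c * conj c with hu_def
  set v : ℂ := 1 - x * conj x with hv_def
  set Y : ℂ := 1 - y * conj y
  have h0 : ‖2 * u ^ 2 * conj c ^ 2 * x ^ 4 - 18 * u * c ^ 2 * conj c ^ 2 * x ^ 3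
      - 24 * c * conj c * u ^ 2 * x ^ 3 - 9 * u ^ 3 * x ^ 3 - 40 / 3 * c ^ 3 * conj c * u * x ^ 2
      - 18 * c ^ 2 * u ^ 2 * x ^ 2 + 8 * c ^ 4 * u * x - 25 / 9 * c ^ 6‖
        ≤ majorantConst ‖c‖ ‖x‖ := by
    refine (norm_sub_le_of_le (norm_add_le_of_le (norm_sub_le_of_le (norm_sub_le_of_le
      (norm_sub_le_of_le (norm_sub_le_of_le (norm_sub_le_of_le le_rfl le_rfl) le_rfl) le_rfl)
      le_rfl) le_rfl) le_rfl) le_rfl).trans_eq ?_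
    simp only [norm_mul, norm_pow, norm_div, RCLike.norm_conj, Complex.norm_ofNat, hu,
      majorantConst]
    ring
  have h1 : ‖u * v * (36 * c ^ 2 * conj c * x + 24 * u * c * x + 40 / 3 * c ^ 3
      - 4 * u * conj c * x ^ 2)‖ ≤ majorantLin ‖c‖ ‖x‖ := by
    rw [norm_mul]
    refine (mul_le_mul_of_nonneg_left (norm_sub_le_of_le (norm_add_le_of_le
      (norm_add_le_of_le le_rfl le_rfl) le_rfl) le_rfl) (norm_nonneg _)).trans_eq ?_
    simp only [norm_mul, norm_pow, norm_div, RCLike.norm_conj, Complex.norm_ofNat, hu, hv,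
      majorantLin]
    ring
  have h2 : ‖u * v * (18 * c ^ 2 * conj x - 16 * u - 2 * u * (x * conj x))‖
      ≤ majorantQuad ‖c‖ ‖x‖ := by
    rw [norm_mul]
    refine (mul_le_mul_of_nonneg_left (norm_sub_le_of_le (norm_sub_le_of_le le_rfl le_rfl) le_rfl)
      (norm_nonneg _)).trans_eq ?_
    simp only [norm_mul, norm_pow, RCLike.norm_conj, Complex.norm_ofNat, hu, hv, majorantQuad]
    ring
  have h3 : ‖18 * u * v * (u * x - c ^ 2)‖ ≤ majorantLast ‖c‖ ‖x‖ := by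
    rw [norm_mul]
    refine (mul_le_mul_of_nonneg_left (norm_sub_le _ _) (norm_nonneg _)).trans_eq ?_
    simp only [norm_mul, norm_pow, Complex.norm_ofNat, hu, hv, majorantLast]
  have hY0 : 0 ≤ 1 - ‖y‖ ^ 2 := by rw [← hY]; exact norm_nonneg _
  have h3' : ‖18 * u * v * (u * x - c ^ 2) * (Y * ζ)‖ ≤ majorantLast ‖c‖ ‖x‖ * (1 - ‖y‖ ^ 2) := by
    rw [norm_mul, norm_mul Y, hY]
    exact mul_le_mul h3 (mul_le_of_le_one_right hY0 hζ) (by positivity)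
      ((norm_nonneg _).trans h3)
  have h1' := mul_le_mul_of_nonneg_right h1 (norm_nonneg y)
  have h2' := mul_le_mul_of_nonneg_right h2 (norm_nonneg (y ^ 2))
  rw [← norm_mul] at h1' h2'
  rw [norm_pow] at h2'
  refine le_trans (le_trans (le_of_eq (congrArg norm ?_)) (norm_add_le_of_le (norm_add_le_of_le
    (norm_add_le_of_le h0 h1') h2') h3')) (majorant_le (norm_nonneg c) hc (norm_nonneg x) hx
      (norm_nonneg y) hy)
  rw [hu_def, hv_def]
  ring

theorem norm_hankelDet_le {f : ℂ → ℂ} (hf : StarlikeRho f) : ‖hankelDet 3 1 f‖ ≤ 1 / 9 := by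
  obtain ⟨hn, hf0, w, hw, hw0, hb, h⟩ := hf
  have hmaps : MapsTo w unitDisc unitDisc := fun z hz =>
    mem_unitDisc.2 ((hb z hz).trans_lt (mem_unitDisc.1 hz))
  have hH := hankelDet_eq_of_schwarz hn hf0 hw hw0 hmaps h
  obtain ⟨c, x, y, ζ, hc, hx, hy, hζ, h₁, h₂, h₃, h₄⟩ :=
    exists_schur_parameters hw hw0 fun z hz => (mem_unitDisc.1 (hmaps hz)).le
  have hle := norm_hankel_schur_le hc hx hy hζ h₂ h₃ h₄
  rw [← h₁, ← hH, norm_mul, Complex.norm_ofNat] at hle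
  linarith

/-! ### Sharpness -/

theorem coeff_pow_three (n : ℕ) : coeff (fun z => z ^ 3) n = if n = 3 then 1 else 0 := by
  have h : (fun z : ℂ => z ^ 3) = fun z => z * (z * z) := by ext z; ring
  have h₂ : AnalyticAt ℂ (fun z : ℂ => z * z) 0 := analyticAt_id.mul analyticAt_id
  rw [h]
  rcases n with _ | _ | n
  · simp [coeff_id_mul_zero]
  · rw [coeff_id_mul_succ h₂, coeff_id_mul_zero]
    simp
  · rw [coeff_id_mul_succ h₂, coeff_id_mul_succ (f := fun z => z) analyticAt_id, coeff_id]
    simp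

theorem norm_pow_three_le {z : ℂ} (hz : z ∈ unitDisc) : ‖z ^ 3‖ ≤ ‖z‖ := by
  rw [norm_pow]
  exact pow_le_of_le_one (norm_nonneg _) (mem_unitDisc.1 hz).le three_ne_zero

theorem analyticOnNhd_pow_three : AnalyticOnNhd ℂ (fun z : ℂ => z ^ 3) unitDisc :=
  fun _ _ => analyticAt_id.pow 3

theorem starlikeRho_extremal : StarlikeRho extremal :=
  ⟨extremal_spec.1, extremal_spec.2.1, fun z => z ^ 3, analyticOnNhd_pow_three, by simp,
    fun _ hz => norm_pow_three_le hz, extremal_spec.2.2⟩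

theorem norm_hankelDet_extremal : ‖hankelDet 3 1 extremal‖ = 1 / 9 := by
  obtain ⟨hn, h0, h⟩ := extremal_spec
  have hH := hankelDet_eq_of_schwarz (w := fun z => z ^ 3) hn h0 analyticOnNhd_pow_three (by simp)
    (fun z hz => mem_unitDisc.2 ((norm_pow_three_le hz).trans_lt (mem_unitDisc.1 hz))) h
  simp only [coeff_pow_three] at hH
  -- For `w = z³` only the term `-16 * coeff w 3 ^ 2` survives.
  have : hankelDet 3 1 extremal = -(1 / 9) := by
    norm_num at hH
    linear_combination hH / 144
  rw [this]
  norm_num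

end PetalStarlike

theorem theorem4 :
    (∀ f : ℂ → ℂ, PetalStarlike.StarlikeRho f →
      PetalStarlike.hankelDet 3 1 f =
        2 * PetalStarlike.coeff f 2 * PetalStarlike.coeff f 3 * PetalStarlike.coeff f 4
          - PetalStarlike.coeff f 3 ^ 3 - PetalStarlike.coeff f 4 ^ 2
          - PetalStarlike.coeff f 2 ^ 2 * PetalStarlike.coeff f 5
          + PetalStarlike.coeff f 3 * PetalStarlike.coeff f 5 ∧
      ‖PetalStarlike.hankelDet 3 1 f‖ ≤ 1 / 9) ∧
    PetalStarlike.StarlikeRho PetalStarlike.extremal ∧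
    ‖PetalStarlike.hankelDet 3 1 PetalStarlike.extremal‖ = 1 / 9 :=
  ⟨fun _ hf => ⟨PetalStarlike.hankelDet_three_one hf.1, PetalStarlike.norm_hankelDet_le hf⟩,
    PetalStarlike.starlikeRho_extremal, PetalStarlike.norm_hankelDet_extremal⟩
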